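/- Let $d\ge 1$, and let $UC_b(\mathbb{R}^d)$ be the Banach space of bounded, uniformly continuous functions $f:\mathbb{R}^d\to\mathbb{R}$ with the norm $\|f\|=\sup_{x\in\mathbb{R}^d}|f(x)|$. Let $C_b^\infty(\mathbb{R}^d)\subset UC_b(\mathbb{R}^d)$ be the subspace of infinitely differentiable functions that are bounded together with all their derivatives. Let $a_1,\dots,a_d,\,b_1,\dots,b_d,\,c\in UC_b(\mathbb{R}^d)$, put $b=(b_1,\dots,b_d)$, and let $H$ be the operator with domain $C_b^\infty(\mathbb{R}^d)$ given by $$(H\varphi)(x)=\sum_{j=1}^d (a_j(x))^2\,\frac{\partial^2\varphi}{\partial x_j^2}(x)+\langle b(x),\nabla\varphi(x)\rangle+c(x)\varphi(x).$$ For $t\ge 0$ let $S(t)$ be the bounded linear operator in $UC_b(\mathbb{R}^d)$ given by $$(S(t)f)(x)=\frac1{4d}\sum_{j=1}^d\Big(f\big(x+2\sqrt d\,a_j(x)\sqrt t\,e_j\big)+f\big(x-2\sqrt d\,a_j(x)\sqrt t\,e_j\big)\Big)+\frac12 f(x+2tb(x))+t\,c(x)f(x),$$ where $e_j$ is the $j$-th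 standard basis vector. Suppose that $H$ is closable in $UC_b(\mathbb{R}^d)$ and that its closure $\overline H$ is the infinitesimal generator of a $C_0$-semigroup $(e^{tH})_{t\ge 0}$ in $UC_b(\mathbb{R}^d)$. Then for every $u_0\in UC_b(\mathbb{R}^d)$ the Cauchy problem $u'(t)=\overline H u(t)$ $(t\geq 0)$, $u(0)=u_0$, has the solution $u(t,x)=(e^{tH}u_0)(x)$, in the following sense. The function $t\mapsto u(t,\cdot)=e^{tH}u_0$ is the unique mild solution, that is, the unique continuous $u:[0,\infty)\to UC_b(\mathbb{R}^d)$ such that $\int_0^t u(s)\,ds\in \mathrm{Dom}(\overline H)$ and $u(t)=u_0+\overline H\int_0^t u(s)\,ds$ for all $t\ge 0$. If $u_0\in \mathrm{Dom}(\overline H)$, it is a classical solution, that is, it is continuously differentiable as a map $[0,\infty)\to UC_b(\mathbb{R}^d)$, takes its values in $\mathrm{Dom}(\overline H)$, and satisfies $u'(t)=\overline H u(t)$ for all $t\ge 0$ and $u(0)=u_0$. The solution is bounded on $[0,T]\times\mathbb{R}^d$ for each $T>0$, is uniformly continuous in $x\in\mathbb{R}^d$ for each $t\ge 0$, and for each $t\ge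 0$ depends on $u_0$ continuously and uniformly with respect to $x$: for every $\varepsilon>0$ there is a $\delta>0$ such that for all $v_0\in UC_b(\mathbb{R}^d)$ with $\|v_0-u_0\|\le\delta$ one has $\sup_{x}|(e^{tH}v_0)(x)-(e^{tH}u_0)(x)|\le\varepsilon$. For all $x\in\mathbb{R}^d$ and $t\ge 0$, $$u(t,x)=(e^{tH}u_0)(x)=\lim_{n\to\infty}\big(S(t/n)^n u_0\big)(x),$$ where $S(t/n)^n$ is the composition of $n$ copies of $S(t/n)$. For each fixed $t$ the limit holds in the norm of $UC_b(\mathbb{R}^d)$, and it is uniform in $t\in[0,t_0]$ for each $t_0>0$: $$\lim_{n\to\infty}\ \sup_{t\in[0,t_0]}\big\|e^{tH}u_0-S(t/n)^n u_0\big\|=0.$$ -/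

import Mathlib

open Filter Topology Set
open scoped ContDiff BoundedContinuousFunction

noncomputable section

namespace DiffusionSemigroup

/-- The space `ℝ^d` with its Euclidean norm. -/
abbrev Rd (d : ℕ) : Type := EuclideanSpace ℝ (Fin d)

/-- The `j`-th standard basis vector of `ℝ^d`. -/
def stdVec {d : ℕ} (j : Fin d) : Rd d := EuclideanSpace.single j (1 : ℝ)

/-! ### Bounded uniformly continuous functions -/

/-- `f : ℝ^d → ℝ` is bounded and uniformly continuous. -/
def IsBUC {d : ℕ} (f : Rd d → ℝ) : Prop :=
  (∃ C : ℝ, ∀ x, |f x| ≤ C) ∧ UniformContinuous f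

/-- The subspace of uniformly continuous functions in the space of bounded continuous functions
`ℝ^d → ℝ` with the sup norm. -/
def ucbSubmodule (d : ℕ) : Submodule ℝ (Rd d →ᵇ ℝ) where
  carrier := {f | UniformContinuous f}
  add_mem' := by
    intro f g hf hg
    exact UniformContinuous.add (f := fun x => f x) (g := fun x => g x) hf hg
  zero_mem' := uniformContinuous_const
  smul_mem' := by
    intro r f hf
    exact UniformContinuous.const_smul (f := fun x => f x) hf r

/-- `UC_b(ℝ^d)`: the space of bounded uniformly continuous functions `ℝ^d → ℝ` with the sup
norm. -/
def UCb (d : ℕ) : Type := ucbSubmodule d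

instance instNormedAddCommGroupUCb (d : ℕ) : NormedAddCommGroup (UCb d) :=
  inferInstanceAs (NormedAddCommGroup (ucbSubmodule d))

instance instNormedSpaceUCb (d : ℕ) : NormedSpace ℝ (UCb d) :=
  inferInstanceAs (NormedSpace ℝ (ucbSubmodule d))

/-- The underlying bounded continuous function. -/
def UCb.toBCF {d : ℕ} (f : UCb d) : Rd d →ᵇ ℝ := f.1

/-- Elements of `UC_b(ℝ^d)` are functions on `ℝ^d`. -/
instance instCoeFunUCb (d : ℕ) : CoeFun (UCb d) (fun _ => Rd d → ℝ) :=
  ⟨fun f => ⇑f.toBCF⟩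

theorem ucb_ext {d : ℕ} {f g : UCb d} (h : ∀ x, f x = g x) : f = g :=
  Subtype.ext (BoundedContinuousFunction.ext h)

theorem UCb.abs_apply_le {d : ℕ} (f : UCb d) (x : Rd d) : |f x| ≤ ‖f‖ :=
  f.toBCF.norm_coe_le_norm x

theorem UCb.norm_le {d : ℕ} {f : UCb d} {C : ℝ} (hC : 0 ≤ C) : ‖f‖ ≤ C ↔ ∀ x, |f x| ≤ C :=
  BoundedContinuousFunction.norm_le (f := f.toBCF) hC

theorem UCb.isBUC {d : ℕ} (f : UCb d) : IsBUC (fun x => f x) :=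
  ⟨⟨‖f‖, fun x => f.abs_apply_le x⟩, f.2⟩

/-- A bounded uniformly continuous function, as an element of `UC_b(ℝ^d)`. -/
def mkUCb {d : ℕ} (f : Rd d → ℝ) (hf : IsBUC f) : UCb d :=
  ⟨BoundedContinuousFunction.ofNormedAddCommGroup f hf.2.continuous hf.1.choose
    hf.1.choose_spec, hf.2⟩

@[simp]
theorem mkUCb_apply {d : ℕ} (f : Rd d → ℝ) (hf : IsBUC f) (x : Rd d) : (mkUCb f hf) x = f x := rfl

@[simp]
theorem UCb.add_apply {d : ℕ} (f g : UCb d) (x : Rd d) : (f + g) x = f x + g x := rfl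

@[simp]
theorem UCb.sub_apply {d : ℕ} (f g : UCb d) (x : Rd d) : (f - g) x = f x - g x := rfl

@[simp]
theorem UCb.smul_apply {d : ℕ} (r : ℝ) (f : UCb d) (x : Rd d) : (r • f) x = r * f x := rfl

/-- `UC_b(ℝ^d)` is a Banach space. -/
instance instCompleteSpaceUCb (d : ℕ) : CompleteSpace (UCb d) := by
  have hc : IsClosed ((ucbSubmodule d : Submodule ℝ (Rd d →ᵇ ℝ)) : Set (Rd d →ᵇ ℝ)) := by
    refine isClosed_of_closure_subset fun f hf => ?_
    obtain ⟨u, hu, hlim⟩ := mem_closure_iff_seq_limit.1 hf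
    exact (BoundedContinuousFunction.tendsto_iff_tendstoUniformly.1 hlim).uniformContinuous
      (Frequently.of_forall hu)
  exact hc.completeSpace_coe

theorem IsBUC.add {d : ℕ} {f g : Rd d → ℝ} (hf : IsBUC f) (hg : IsBUC g) :
    IsBUC (fun x => f x + g x) := by
  obtain ⟨⟨C, hC⟩, hfu⟩ := hf
  obtain ⟨⟨D, hD⟩, hgu⟩ := hg
  exact ⟨⟨C + D, fun x => (abs_add_le _ _).trans (add_le_add (hC x) (hD x))⟩, hfu.add hgu⟩

theorem IsBUC.const {d : ℕ} (r : ℝ) : IsBUC (fun _ : Rd d => r) :=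
  ⟨⟨|r|, fun _ => le_rfl⟩, uniformContinuous_const⟩

theorem IsBUC.mul {d : ℕ} {f g : Rd d → ℝ} (hf : IsBUC f) (hg : IsBUC g) :
    IsBUC (fun x => f x * g x) := by
  obtain ⟨⟨C, hC⟩, hfu⟩ := hf
  obtain ⟨⟨D, hD⟩, hgu⟩ := hg
  have hC0 : 0 ≤ C := (abs_nonneg _).trans (hC 0)
  have hD0 : 0 ≤ D := (abs_nonneg _).trans (hD 0)
  refine ⟨⟨C * D, fun x => ?_⟩, ?_⟩
  · rw [abs_mul]
    exact mul_le_mul (hC x) (hD x) (abs_nonneg _) hC0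
  · rw [Metric.uniformContinuous_iff] at hfu hgu ⊢
    intro ε hε
    obtain ⟨δ₁, h₁, H₁⟩ := hfu (ε / (2 * (D + 1))) (by positivity)
    obtain ⟨δ₂, h₂, H₂⟩ := hgu (ε / (2 * (C + 1))) (by positivity)
    refine ⟨min δ₁ δ₂, lt_min h₁ h₂, fun x y hxy => ?_⟩
    have e₁ := H₁ (hxy.trans_le (min_le_left _ _))
    have e₂ := H₂ (hxy.trans_le (min_le_right _ _))
    rw [Real.dist_eq] at e₁ e₂ ⊢
    have e : f x * g x - f y * g y = (f x - f y) * g x + f y * (g x - g y) := by ring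
    rw [lt_div_iff₀ (by positivity)] at e₁ e₂
    rw [e]
    calc |(f x - f y) * g x + f y * (g x - g y)|
        ≤ |f x - f y| * |g x| + |f y| * |g x - g y| := by
          rw [← abs_mul, ← abs_mul]; exact abs_add_le _ _
      _ ≤ |f x - f y| * D + C * |g x - g y| := by
          gcongr
          · exact hD x
          · exact hC y
      _ < ε := by nlinarith [abs_nonneg (f x - f y), abs_nonneg (g x - g y)]

theorem IsBUC.sum {d : ℕ} {ι : Type*} (s : Finset ι) {f : ι → Rd d → ℝ}
    (hf : ∀ i, IsBUC (f i)) : IsBUC (fun x => ∑ i ∈ s, f i x) := by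
  classical
  induction s using Finset.induction_on with
  | empty => simpa using IsBUC.const 0
  | insert i s hi ih => simpa [Finset.sum_insert hi] using (hf i).add ih

theorem IsBUC.comp {d : ℕ} {f : Rd d → ℝ} (hf : IsBUC f) {g : Rd d → Rd d}
    (hg : UniformContinuous g) : IsBUC (fun x => f (g x)) := by
  obtain ⟨⟨C, hC⟩, hfu⟩ := hf
  exact ⟨⟨C, fun x => hC _⟩, hfu.comp hg⟩

/-! ### Smooth functions with bounded derivatives and the operator `H` -/

/-- `φ ∈ C_b^∞(ℝ^d)`: `φ` is infinitely differentiable, and `φ` and its derivatives of all orders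
are bounded. -/
def IsCbInfty {d : ℕ} (φ : Rd d → ℝ) : Prop :=
  ContDiff ℝ ∞ φ ∧ ∀ n : ℕ, ∃ C : ℝ, ∀ x, ‖iteratedFDeriv ℝ n φ x‖ ≤ C

/-- The partial derivative `∂φ/∂x_j`. -/
def partialD {d : ℕ} (j : Fin d) (φ : Rd d → ℝ) : Rd d → ℝ :=
  fun x => fderiv ℝ φ x (stdVec j)

theorem IsCbInfty.differentiable {d : ℕ} {φ : Rd d → ℝ} (h : IsCbInfty φ) :
    Differentiable ℝ φ := h.1.differentiable (by simp)

theorem IsCbInfty.add {d : ℕ} {φ ψ : Rd d → ℝ} (hφ : IsCbInfty φ) (hψ : IsCbInfty ψ) :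
    IsCbInfty (φ + ψ) := by
  refine ⟨hφ.1.add hψ.1, fun n => ?_⟩
  obtain ⟨C, hC⟩ := hφ.2 n
  obtain ⟨D, hD⟩ := hψ.2 n
  refine ⟨C + D, fun x => ?_⟩
  rw [iteratedFDeriv_add_apply (hφ.1.of_le (by exact_mod_cast le_top)).contDiffAt
    (hψ.1.of_le (by exact_mod_cast le_top)).contDiffAt]
  exact (norm_add_le _ _).trans (add_le_add (hC x) (hD x))

theorem IsCbInfty.const_smul {d : ℕ} {φ : Rd d → ℝ} (hφ : IsCbInfty φ) (r : ℝ) :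
    IsCbInfty (r • φ) := by
  refine ⟨contDiff_const.smul hφ.1, fun n => ?_⟩
  obtain ⟨C, hC⟩ := hφ.2 n
  refine ⟨‖r‖ * C, fun x => ?_⟩
  rw [iteratedFDeriv_const_smul_apply (hφ.1.of_le (by exact_mod_cast le_top)).contDiffAt,
    norm_smul]
  exact mul_le_mul_of_nonneg_left (hC x) (norm_nonneg _)

theorem IsCbInfty.zero {d : ℕ} : IsCbInfty (0 : Rd d → ℝ) := by
  refine ⟨contDiff_const, fun n => ⟨0, fun x => ?_⟩⟩
  simp

theorem IsCbInfty.partialD {d : ℕ} {φ : Rd d → ℝ} (hφ : IsCbInfty φ) (j : Fin d) :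
    IsCbInfty (partialD j φ) := by
  have h1 : ContDiff ℝ ∞ (fderiv ℝ φ) := hφ.1.fderiv_right (by simp)
  refine ⟨h1.clm_apply contDiff_const, fun n => ?_⟩
  obtain ⟨C, hC⟩ := hφ.2 (n + 1)
  refine ⟨‖stdVec j‖ * C, fun x => ?_⟩
  refine (norm_iteratedFDeriv_clm_apply_const h1.contDiffAt
    (by exact_mod_cast le_top)).trans ?_
  rw [norm_iteratedFDeriv_fderiv]
  exact mul_le_mul_of_nonneg_left (hC x) (norm_nonneg _)

theorem IsCbInfty.isBUC {d : ℕ} {φ : Rd d → ℝ} (hφ : IsCbInfty φ) : IsBUC φ := by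
  obtain ⟨C, hC⟩ := hφ.2 0
  obtain ⟨D, hD⟩ := hφ.2 1
  refine ⟨⟨C, fun x => by simpa using hC x⟩, ?_⟩
  have hL : LipschitzWith (Real.toNNReal D) φ := by
    refine lipschitzWith_of_nnnorm_fderiv_le hφ.differentiable fun x => ?_
    rw [← NNReal.coe_le_coe, coe_nnnorm]
    refine le_trans ?_ (Real.le_coe_toNNReal D)
    have := hD x
    rwa [norm_iteratedFDeriv_one] at this
  exact hL.uniformContinuous

/-- `C_b^∞(ℝ^d)` as a linear subspace of `UC_b(ℝ^d)`. -/
def CbInfty (d : ℕ) : Submodule ℝ (UCb d) where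
  carrier := {φ | IsCbInfty (fun x => φ x)}
  add_mem' := by
    intro φ ψ hφ hψ
    exact IsCbInfty.add hφ hψ
  zero_mem' := IsCbInfty.zero
  smul_mem' := by
    intro r φ hφ
    exact IsCbInfty.const_smul hφ r

/-- The differential expression
`(Hφ)(x) = ∑_j a_j(x)² ∂²φ/∂x_j²(x) + ⟨b(x), ∇φ(x)⟩ + c(x) φ(x)`. -/
def diffExpr {d : ℕ} (a b : Fin d → UCb d) (c : UCb d) (φ : Rd d → ℝ) (x : Rd d) : ℝ :=
  ∑ j, (a j x) ^ 2 * partialD j (partialD j φ) x + ∑ j, b j x * partialD j φ x + c x * φ x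

theorem isBUC_diffExpr {d : ℕ} (a b : Fin d → UCb d) (c : UCb d) {φ : Rd d → ℝ}
    (hφ : IsCbInfty φ) : IsBUC (diffExpr a b c φ) := by
  unfold diffExpr
  refine IsBUC.add (IsBUC.add (IsBUC.sum _ fun j => ?_) (IsBUC.sum _ fun j => ?_)) ?_
  · simp only [pow_two]
    exact ((a j).isBUC.mul (a j).isBUC).mul ((hφ.partialD j).partialD j).isBUC
  · exact (b j).isBUC.mul (hφ.partialD j).isBUC
  · exact c.isBUC.mul hφ.isBUC

theorem partialD_add {d : ℕ} {φ ψ : Rd d → ℝ} (hφ : IsCbInfty φ) (hψ : IsCbInfty ψ)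
    (j : Fin d) : partialD j (φ + ψ) = partialD j φ + partialD j ψ := by
  funext x
  simp [partialD, fderiv_add (hφ.differentiable x) (hψ.differentiable x)]

theorem partialD_const_smul {d : ℕ} {φ : Rd d → ℝ} (hφ : IsCbInfty φ) (r : ℝ)
    (j : Fin d) : partialD j (r • φ) = r • partialD j φ := by
  funext x
  simp [partialD, fderiv_const_smul (hφ.differentiable x)]

/-- The operator `H`, an unbounded operator in `UC_b(ℝ^d)` with domain `C_b^∞(ℝ^d)`. -/
def opH {d : ℕ} (a b : Fin d → UCb d) (c : UCb d) : UCb d →ₗ.[ℝ] UCb d where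
  domain := CbInfty d
  toFun :=
    { toFun := fun φ =>
        mkUCb (diffExpr a b c (fun x => (φ : UCb d) x)) (isBUC_diffExpr a b c φ.2)
      map_add' := by
        intro φ ψ
        refine ucb_ext fun x => ?_
        have hφ : IsCbInfty (fun x => (φ : UCb d) x) := φ.2
        have hψ : IsCbInfty (fun x => (ψ : UCb d) x) := ψ.2
        change diffExpr a b c ((fun x => (φ : UCb d) x) + fun x => (ψ : UCb d) x) x =
          diffExpr a b c (fun x => (φ : UCb d) x) x + diffExpr a b c (fun x => (ψ : UCb d) x) x
        simp only [diffExpr, partialD_add hφ hψ,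
          partialD_add (hφ.partialD _) (hψ.partialD _), Pi.add_apply, mul_add,
          Finset.sum_add_distrib]
        ring
      map_smul' := by
        intro r φ
        refine ucb_ext fun x => ?_
        have hφ : IsCbInfty (fun x => (φ : UCb d) x) := φ.2
        change diffExpr a b c (r • fun x => (φ : UCb d) x) x =
          r * diffExpr a b c (fun x => (φ : UCb d) x) x
        simp only [diffExpr, partialD_const_smul hφ, partialD_const_smul (hφ.partialD _),
          Pi.smul_apply, smul_eq_mul, mul_add, Finset.mul_sum, mul_left_comm] }

/-! ### The translation operators `S(t)` -/

/-- The vector `b(x) = (b_1(x), …, b_d(x))`. -/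
def vecB {d : ℕ} (b : Fin d → UCb d) (x : Rd d) : Rd d := WithLp.toLp 2 (fun j => b j x)

/-- The formula for `(S(t)f)(x)`. -/
def transExpr {d : ℕ} (a b : Fin d → UCb d) (c : UCb d) (t : ℝ) (f : Rd d → ℝ) (x : Rd d) : ℝ :=
  1 / (4 * (d : ℝ)) * ∑ j,
      (f (x + (2 * √(d : ℝ) * a j x * √t) • stdVec j) +
        f (x - (2 * √(d : ℝ) * a j x * √t) • stdVec j)) +
    1 / 2 * f (x + (2 * t) • vecB b x) + t * c x * f x

theorem uniformContinuous_vecB {d : ℕ} (b : Fin d → UCb d) : UniformContinuous (vecB b) :=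
  (PiLp.uniformContinuous_toLp 2 _).comp (uniformContinuous_pi.2 fun j => (b j).2)

theorem isBUC_transExpr {d : ℕ} (a b : Fin d → UCb d) (c : UCb d) (t : ℝ) (f : UCb d) :
    IsBUC (transExpr a b c t (fun x => f x)) := by
  have hs : ∀ j : Fin d, UniformContinuous
      (fun x => (2 * √(d : ℝ) * a j x * √t) • stdVec (d := d) j) := by
    intro j
    have h1 : UniformContinuous (fun x => 2 * √(d : ℝ) * a j x * √t) :=
      (((IsBUC.const (2 * √(d : ℝ))).mul (a j).isBUC).mul (IsBUC.const √t)).2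
    exact ((ContinuousLinearMap.toSpanSingleton ℝ
      (stdVec (d := d) j)).uniformContinuous).comp h1
  unfold transExpr
  refine IsBUC.add (IsBUC.add ((IsBUC.const _).mul (IsBUC.sum _ fun j => ?_))
    ((IsBUC.const _).mul ?_)) (((IsBUC.const t).mul c.isBUC).mul f.isBUC)
  · exact (f.isBUC.comp (uniformContinuous_id.add (hs j))).add
      (f.isBUC.comp (uniformContinuous_id.sub (hs j)))
  · exact f.isBUC.comp (uniformContinuous_id.add ((uniformContinuous_vecB b).const_smul (2 * t)))

theorem abs_transExpr_le {d : ℕ} (a b : Fin d → UCb d) (c : UCb d) (t : ℝ) (f : UCb d)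
    (x : Rd d) : |transExpr a b c t (fun x => f x) x| ≤ (1 + |t| * ‖c‖) * ‖f‖ := by
  have hf : ∀ y, |f y| ≤ ‖f‖ := f.abs_apply_le
  have hc : |c x| ≤ ‖c‖ := c.abs_apply_le x
  have h0 : (0 : ℝ) ≤ ‖f‖ := norm_nonneg f
  have hsum : |∑ j : Fin d, (f (x + (2 * √(d : ℝ) * a j x * √t) • stdVec j) +
        f (x - (2 * √(d : ℝ) * a j x * √t) • stdVec j))| ≤ d * (2 * ‖f‖) := by
    refine (Finset.abs_sum_le_sum_abs _ _).trans ?_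
    refine (Finset.sum_le_card_nsmul _ _ (2 * ‖f‖) fun j _ => ?_).trans (by simp)
    refine (abs_add_le _ _).trans ?_
    linarith [hf (x + (2 * √(d : ℝ) * a j x * √t) • stdVec j),
      hf (x - (2 * √(d : ℝ) * a j x * √t) • stdVec j)]
  have h1 : |1 / (4 * (d : ℝ)) * ∑ j : Fin d, (f (x + (2 * √(d : ℝ) * a j x * √t) • stdVec j) +
        f (x - (2 * √(d : ℝ) * a j x * √t) • stdVec j))| ≤ 1 / 2 * ‖f‖ := by
    rw [abs_mul, abs_of_nonneg (by positivity : (0 : ℝ) ≤ 1 / (4 * (d : ℝ)))]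
    refine (mul_le_mul_of_nonneg_left hsum (by positivity)).trans ?_
    rcases Nat.eq_zero_or_pos d with hd | hd
    · subst hd
      simp
    · have : (0 : ℝ) < d := by exact_mod_cast hd
      apply le_of_eq
      field_simp
      norm_num
  have h2 : |1 / 2 * f (x + (2 * t) • vecB b x)| ≤ 1 / 2 * ‖f‖ := by
    rw [abs_mul, abs_of_nonneg (by norm_num : (0 : ℝ) ≤ 1 / 2)]
    linarith [hf (x + (2 * t) • vecB b x)]
  have h3 : |t * c x * f x| ≤ |t| * ‖c‖ * ‖f‖ := by
    rw [abs_mul, abs_mul]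
    gcongr
    exact hf x
  unfold transExpr
  refine (abs_add_le _ _).trans ?_
  refine (add_le_add ((abs_add_le _ _).trans (add_le_add h1 h2)) h3).trans ?_
  apply le_of_eq
  ring

/-- The bounded linear operator `S(t)` in `UC_b(ℝ^d)` (of interest for `t ≥ 0`):
`(S(t)f)(x) = 1/(4d) ∑_j (f(x + 2√d a_j(x) √t e_j) + f(x - 2√d a_j(x) √t e_j))
  + 1/2 f(x + 2 t b(x)) + t c(x) f(x)`. -/
def opS {d : ℕ} (a b : Fin d → UCb d) (c : UCb d) (t : ℝ) : UCb d →L[ℝ] UCb d :=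
  LinearMap.mkContinuous
    { toFun := fun f => mkUCb (transExpr a b c t (fun x => f x)) (isBUC_transExpr a b c t f)
      map_add' := by
        intro f g
        refine ucb_ext fun x => ?_
        change transExpr a b c t ((fun x => f x) + fun x => g x) x =
          transExpr a b c t (fun x => f x) x + transExpr a b c t (fun x => g x) x
        simp only [transExpr, Pi.add_apply, Finset.sum_add_distrib]
        ring
      map_smul' := by
        intro r f
        refine ucb_ext fun x => ?_
        change transExpr a b c t (r • fun x => f x) x = r * transExpr a b c t (fun x => f x) x
        simp only [transExpr, Pi.smul_apply, smul_eq_mul, Finset.sum_add_distrib,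
          ← Finset.mul_sum]
        ring }
    (1 + |t| * ‖c‖)
    (fun f => (UCb.norm_le (by positivity)).2
      fun x => abs_transExpr_le a b c t f x)

/-! ### Semigroups, generators and solutions of the abstract Cauchy problem -/

/-- `(V(t))_{t ≥ 0}` is a `C₀`-semigroup (values at negative `t` play no role). -/
structure IsC0Semigroup {F : Type*} [NormedAddCommGroup F] [NormedSpace ℝ F]
    (V : ℝ → F →L[ℝ] F) : Prop where
  map_zero : V 0 = ContinuousLinearMap.id ℝ F
  map_add : ∀ s t : ℝ, 0 ≤ s → 0 ≤ t → V (s + t) = (V s).comp (V t)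
  continuousOn : ∀ f : F, ContinuousOn (fun t => V t f) (Ici 0)

/-- `L` is the infinitesimal generator of `(V(t))_{t ≥ 0}`: the domain of `L` consists of those `f`
for which `(V(t)f - f)/t` converges as `t → +0`, and `Lf` is the limit. -/
def IsGenerator {F : Type*} [NormedAddCommGroup F] [NormedSpace ℝ F]
    (V : ℝ → F →L[ℝ] F) (L : F →ₗ.[ℝ] F) : Prop :=
  ∀ f g : F, (f, g) ∈ L.graph ↔ Tendsto (fun t : ℝ => t⁻¹ • (V t f - f)) (𝓝[>] 0) (𝓝 g)

/-- `u : [0, ∞) → F` is a mild solution of `u' = Lu`, `u(0) = u₀`: it is continuous, and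
`∫₀ᵗ u(s) ds ∈ Dom(L)` and `u(t) = u₀ + L ∫₀ᵗ u(s) ds` for all `t ≥ 0`. -/
def IsMildSolution {F : Type*} [NormedAddCommGroup F] [NormedSpace ℝ F]
    (L : F →ₗ.[ℝ] F) (u₀ : F) (u : ℝ → F) : Prop :=
  ContinuousOn u (Ici 0) ∧ ∀ t : ℝ, 0 ≤ t → (∫ s in (0 : ℝ)..t, u s, u t - u₀) ∈ L.graph

/-- `u : [0, ∞) → F` is a classical solution of `u' = Lu`, `u(0) = u₀`: it is continuously
differentiable, `u(t) ∈ Dom(L)` and `u'(t) = Lu(t)` for all `t ≥ 0`, and `u(0) = u₀`. -/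
def IsClassicalSolution {F : Type*} [NormedAddCommGroup F] [NormedSpace ℝ F]
    (L : F →ₗ.[ℝ] F) (u₀ : F) (u : ℝ → F) : Prop :=
  u 0 = u₀ ∧ ∃ u' : ℝ → F, ContinuousOn u' (Ici 0) ∧
    ∀ t : ℝ, 0 ≤ t → HasDerivWithinAt u (u' t) (Ici 0) t ∧ (u t, u' t) ∈ L.graph

end DiffusionSemigroup

end

open DiffusionSemigroup

/-! The well-posedness claims are general semigroup theory. Orbits are mild solutions, because
applying `V h` to an integral of the orbit shifts the window of integration. They are the only ones,
because any solution of `W' = LW` starting at `0` is annihilated by the interpolation `s ↦ V (t - s)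
(W s)`, which has zero right derivative.

The limit formula is Chernoff's theorem, resting on stability, `‖S h‖ ≤ 1 + ‖c‖ h`, and consistency,
`(S h φ - φ) / h → H φ` for `φ ∈ C_b^∞`. Consistency is available only on the core `C_b^∞`, which
orbits of `V` need not meet, so the orbit cannot be inserted into the scheme directly. It is first
smoothed by the discrete resolvent `R h = (z - (S h - 1) / h)⁻¹`, which stability bounds uniformly
in `h`. Consistency says that `R h (z φ - H φ) - φ → 0` on the core. Uniform boundedness extends
this to the closure of the graph, uniformly on compact sets, hence along orbit segments
(`eventually_resolvent_orbit`).

For `f` in the domain of `L²` and `g = z f - L f`, the points `R h (V (k h) g)` stay close to `V (k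
h) f` and satisfy the recursion of `S h` up to `o(h)` per step. Stability sums these defects to
`o(1)` over `n` steps (`norm_pow_sub_le`). Density of the domain of `L²` together with uniform
bounds gives all initial data. -/

namespace DiffusionSemigroup

/-! ### Semigroups, generators and the abstract Cauchy problem -/

section Semigroup

variable {F : Type*} [NormedAddCommGroup F] [NormedSpace ℝ F]
  {V : ℝ → F →L[ℝ] F} {L : F →ₗ.[ℝ] F}

theorem IsC0Semigroup.zero_apply (hV : IsC0Semigroup V) (f : F) : V 0 f = f := by
  rw [hV.map_zero]; rfl

theorem IsC0Semigroup.add_apply (hV : IsC0Semigroup V) {s t : ℝ} (hs : 0 ≤ s) (ht : 0 ≤ t)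
    (f : F) : V (s + t) f = V s (V t f) := by
  rw [hV.map_add s t hs ht]; rfl

theorem IsC0Semigroup.commute_apply (hV : IsC0Semigroup V) {s t : ℝ} (hs : 0 ≤ s) (ht : 0 ≤ t)
    (f : F) : V s (V t f) = V t (V s f) := by
  rw [← hV.add_apply hs ht, add_comm, hV.add_apply ht hs]

/-- A `C₀`-semigroup is bounded on compact time intervals. -/
theorem IsC0Semigroup.exists_bound [CompleteSpace F] (hV : IsC0Semigroup V) (T : ℝ) :
    ∃ M : ℝ, 0 < M ∧ ∀ t ∈ Icc 0 T, ‖V t‖ ≤ M := by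
  obtain ⟨M, hM⟩ := banach_steinhaus (g := fun t : Icc (0 : ℝ) T => V t) fun f => by
    obtain ⟨C, hC⟩ := isCompact_Icc.exists_bound_of_continuousOn
      ((hV.continuousOn f).mono (Icc_subset_Ici_self : Icc 0 T ⊆ _))
    exact ⟨C, fun t => hC t t.2⟩
  exact ⟨max M 1, by positivity, fun t ht => (hM ⟨t, ht⟩).trans (le_max_left _ _)⟩

/-- Joint continuity in time and vector: the local bound absorbs the change of vector, and strong
continuity handles the change of time. -/
theorem IsC0Semigroup.tendsto_apply [CompleteSpace F] (hV : IsC0Semigroup V) {ι : Type*}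
    {l : Filter ι} {r : ι → ℝ} {w : ι → F} {s : ℝ} {f : F} (hs : 0 ≤ s)
    (hr : Tendsto r l (𝓝 s)) (hr0 : ∀ᶠ i in l, 0 ≤ r i) (hw : Tendsto w l (𝓝 f)) :
    Tendsto (fun i => V (r i) (w i)) l (𝓝 (V s f)) := by
  obtain ⟨M, hM0, hM⟩ := hV.exists_bound (s + 1)
  have h1 : Tendsto (fun i => V (r i) f) l (𝓝 (V s f)) :=
    (hV.continuousOn f s hs).tendsto.comp (tendsto_nhdsWithin_iff.2 ⟨hr, hr0⟩)
  have h2 : Tendsto (fun i => V (r i) (w i - f)) l (𝓝 0) := by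
    have h3 : Tendsto (fun i => M * ‖w i - f‖) l (𝓝 0) := by
      simpa using ((tendsto_sub_nhds_zero_iff.2 hw).norm).const_mul M
    refine squeeze_zero_norm' ?_ h3
    filter_upwards [hr0, hr.eventually_lt_const (lt_add_one s)] with i hi hi'
    exact (V (r i)).le_of_opNorm_le (hM _ ⟨hi, hi'.le⟩) _
  simpa using h2.add h1

/-- `V s` is continuous and commutes with the difference quotients that define the generator. -/
theorem IsGenerator.map_mem_graph (hV : IsC0Semigroup V) (hL : IsGenerator V L) {s : ℝ}
    (hs : 0 ≤ s) {f g : F} (h : (f, g) ∈ L.graph) : (V s f, V s g) ∈ L.graph := by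
  rw [hL] at h ⊢
  refine (((V s).continuous.tendsto _).comp h).congr' ?_
  filter_upwards [self_mem_nhdsWithin] with t ht
  simp only [Function.comp, map_smul, map_sub]
  rw [hV.commute_apply hs (le_of_lt ht)]

theorem hasDerivWithinAt_Ioi_iff_tendsto {u : ℝ → F} {u' : F} {t : ℝ} :
    HasDerivWithinAt u u' (Ioi t) t ↔
      Tendsto (fun h : ℝ => h⁻¹ • (u (t + h) - u t)) (𝓝[>] 0) (𝓝 u') := by
  rw [hasDerivWithinAt_iff_tendsto_slope' self_notMem_Ioi]
  have : 𝓝[>] t = map (fun h => t + h) (𝓝[>] 0) := by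
    rw [map_add_left_nhdsGT]; simp
  rw [this, tendsto_map'_iff]
  refine tendsto_congr fun h => ?_
  simp [slope, Function.comp]

theorem IsGenerator.hasDerivWithinAt_Ioi (hV : IsC0Semigroup V) (hL : IsGenerator V L) {t : ℝ}
    (ht : 0 ≤ t) {f g : F} (h : (f, g) ∈ L.graph) :
    HasDerivWithinAt (fun t => V t f) (V t g) (Ioi t) t := by
  rw [hasDerivWithinAt_Ioi_iff_tendsto]
  refine ((hL _ _).1 (hL.map_mem_graph hV ht h)).congr' ?_
  filter_upwards [self_mem_nhdsWithin] with s hs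
  rw [add_comm, hV.add_apply (le_of_lt hs) ht]

theorem intervalIntegrable_of_continuousOn_Ici {E : Type*} [NormedAddCommGroup E] {u : ℝ → E} (hu : ContinuousOn u (Ici 0))
    {s t : ℝ} (hs : 0 ≤ s) (ht : 0 ≤ t) : IntervalIntegrable u MeasureTheory.volume s t :=
  (hu.mono fun _ hx => (le_min hs ht).trans hx.1).intervalIntegrable

theorem hasDerivWithinAt_integral_Ici [CompleteSpace F] {u : ℝ → F} (hu : ContinuousOn u (Ici 0))
    {t : ℝ} (ht : 0 ≤ t) :
    HasDerivWithinAt (fun t => ∫ s in (0 : ℝ)..t, u s) (u t) (Ici 0) t := by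
  -- Freezing `u` at `u 0` for negative times gives a function continuous on the whole line with the
  -- same integrals over `[0, x]`.
  have hc : Continuous (fun s => u (max s 0)) :=
    hu.comp_continuous (by fun_prop) fun s => mem_Ici.2 (le_max_right _ _)
  have h := (hc.integral_hasStrictDerivAt 0 t).hasDerivAt.hasDerivWithinAt (s := Ici 0)
  rw [max_eq_left ht] at h
  have e : ∀ x ∈ Ici (0 : ℝ), ∫ s in (0 : ℝ)..x, u s = ∫ s in (0 : ℝ)..x, u (max s 0) := by
    intro x hx
    refine intervalIntegral.integral_congr fun s hs => ?_
    rw [uIcc_of_le hx] at hs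
    simp [max_eq_left hs.1]
  exact h.congr e (e t ht)

/-- `∫₀ᵗ V(s)f ds` lies in the domain of the generator, which maps it to `V(t)f - f`. -/
theorem IsGenerator.integral_mem_graph [CompleteSpace F] (hV : IsC0Semigroup V)
    (hL : IsGenerator V L) {t : ℝ} (ht : 0 ≤ t) (f : F) :
    (∫ s in (0 : ℝ)..t, V s f, V t f - f) ∈ L.graph := by
  rw [hL]
  have hc := hV.continuousOn f
  have hd : ∀ r : ℝ, 0 ≤ r → Tendsto
      (fun h : ℝ => h⁻¹ • ((∫ s in (0 : ℝ)..(r + h), V s f) - ∫ s in (0 : ℝ)..r, V s f))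
      (𝓝[>] 0) (𝓝 (V r f)) := fun r hr => hasDerivWithinAt_Ioi_iff_tendsto.1
        ((hasDerivWithinAt_integral_Ici hc hr).mono (Ioi_subset_Ici hr))
  have h0 := hd 0 le_rfl
  rw [hV.zero_apply] at h0
  refine ((hd t ht).sub h0).congr' ?_
  filter_upwards [self_mem_nhdsWithin] with h hh
  have hh : 0 ≤ h := le_of_lt hh
  -- The shifted window overlaps the original one, so the difference of the two integrals is the
  -- integral over `[t, t + h]` minus that over `[0, h]`.
  have e1 : V h (∫ s in (0 : ℝ)..t, V s f) = ∫ s in h..(t + h), V s f := by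
    rw [← ContinuousLinearMap.intervalIntegral_comp_comm _
      (intervalIntegrable_of_continuousOn_Ici hc le_rfl ht)]
    have : ∫ s in (0 : ℝ)..t, V h (V s f) = ∫ s in (0 : ℝ)..t, V (s + h) f := by
      refine intervalIntegral.integral_congr fun s hs => ?_
      rw [uIcc_of_le ht] at hs
      rw [add_comm, hV.add_apply hh hs.1]
    rw [this, intervalIntegral.integral_comp_add_right (fun s => V s f)]
    simp
  have e2 : (∫ s in (0 : ℝ)..h, V s f) + ∫ s in h..(t + h), V s f =
      ∫ s in (0 : ℝ)..(t + h), V s f :=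
    intervalIntegral.integral_add_adjacent_intervals
      (intervalIntegrable_of_continuousOn_Ici hc le_rfl hh)
      (intervalIntegrable_of_continuousOn_Ici hc hh (by positivity))
  rw [← smul_sub, e1, ← e2]
  simp only [zero_add, intervalIntegral.integral_same, sub_zero]
  congr 1
  abel

theorem IsC0Semigroup.tendsto_average [CompleteSpace F] (hV : IsC0Semigroup V) (f : F) :
    Tendsto (fun h : ℝ => h⁻¹ • ∫ s in (0 : ℝ)..h, V s f) (𝓝[>] 0) (𝓝 f) := by
  have := hasDerivWithinAt_Ioi_iff_tendsto.1
    ((hasDerivWithinAt_integral_Ici (hV.continuousOn f) le_rfl).mono (Ioi_subset_Ici le_rfl))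
  simpa [hV.zero_apply] using this

theorem IsGenerator.isMildSolution [CompleteSpace F] (hV : IsC0Semigroup V)
    (hL : IsGenerator V L) (f : F) : IsMildSolution L f (fun t => V t f) :=
  ⟨hV.continuousOn f, fun _ ht => hL.integral_mem_graph hV ht f⟩

theorem IsGenerator.isClassicalSolution [CompleteSpace F] (hV : IsC0Semigroup V)
    (hL : IsGenerator V L) {f : F} (hf : f ∈ L.domain) :
    IsClassicalSolution L f (fun t => V t f) := by
  have hg := L.mem_graph ⟨f, hf⟩
  set g := L ⟨f, hf⟩
  have hc := hV.continuousOn g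
  refine ⟨hV.zero_apply f, fun t => V t g, hc, fun t ht => ⟨?_, hL.map_mem_graph hV ht hg⟩⟩
  -- The generator controls right derivatives only. Writing the orbit as the integral of the
  -- continuous function `V s g` upgrades this to a derivative within `[0, ∞)`.
  have e : ∀ r ∈ Ici (0 : ℝ), V r f = (∫ s in (0 : ℝ)..r, V s g) + f := fun r hr => by
    rw [intervalIntegral.integral_eq_sub_of_hasDeriv_right_of_le hr
      ((hV.continuousOn f).mono Icc_subset_Ici_self)
      (fun x hx => hL.hasDerivWithinAt_Ioi hV hx.1.le hg)
      (intervalIntegrable_of_continuousOn_Ici hc le_rfl hr), hV.zero_apply]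
    abel
  exact ((hasDerivWithinAt_integral_Ici hc ht).add_const f).congr e (e t ht)

/-- A solution of `W' = LW` with `W(0) = 0` vanishes. -/
theorem IsGenerator.eq_zero_of_hasDerivWithinAt [CompleteSpace F] (hV : IsC0Semigroup V)
    (hL : IsGenerator V L) {W w : ℝ → F} (h0 : W 0 = 0) (hW : ContinuousOn W (Ici 0))
    (hd : ∀ t, 0 ≤ t → HasDerivWithinAt W (w t) (Ioi t) t)
    (hg : ∀ t, 0 ≤ t → (W t, w t) ∈ L.graph) {t : ℝ} (ht : 0 ≤ t) : W t = 0 := by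
  -- The interpolation equals `V t (W 0) = 0` at `s = 0` and `W t` at `s = t`.
  have key := constant_of_has_deriv_right_zero (f := fun s => V (t - s) (W s)) (a := 0) (b := t)
    ?_ ?_ t ⟨ht, le_rfl⟩
  · simpa [h0, hV.zero_apply] using key
  · intro s hs
    refine hV.tendsto_apply (sub_nonneg.2 hs.2) ?_ ?_
      ((hW.mono ((Icc_subset_Ici_self : Icc 0 t ⊆ Ici 0)) s hs).tendsto)
    · exact (Continuous.tendsto (by fun_prop) s).mono_left nhdsWithin_le_nhds
    · filter_upwards [self_mem_nhdsWithin] with r hr using sub_nonneg.2 hr.2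
  · intro s hs
    rw [← hasDerivWithinAt_Ioi_iff_Ici, hasDerivWithinAt_Ioi_iff_tendsto]
    -- The quotients of `W` and of the orbit starting at `W s` have the same limit `w s`. Applying
    -- `V (t - s - h)` to their difference gives the quotient of the interpolation.
    have h1 := (hasDerivWithinAt_Ioi_iff_tendsto.1 (hd s hs.1)).sub ((hL _ _).1 (hg s hs.1))
    rw [sub_self] at h1
    have h2 : ∀ᶠ h : ℝ in 𝓝[>] 0, h ≤ t - s :=
      eventually_nhdsWithin_of_eventually_nhds (eventually_le_nhds (sub_pos.2 hs.2))
    have h3 := hV.tendsto_apply (r := fun h => t - s - h) (sub_nonneg.2 hs.2.le)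
      (by simpa using ((Continuous.tendsto (f := fun h => t - s - h) (by fun_prop)
        (0 : ℝ)).mono_left (nhdsWithin_le_nhds (s := Ioi 0))))
      (by filter_upwards [h2] with h hh using sub_nonneg.2 hh) h1
    rw [map_zero] at h3
    refine h3.congr' ?_
    filter_upwards [h2, self_mem_nhdsWithin] with h hh hh0
    have e : V (t - s) (W s) = V (t - s - h) (V h (W s)) := by
      rw [← hV.add_apply (sub_nonneg.2 hh) (le_of_lt hh0), sub_add_cancel]
    rw [e, sub_add_eq_sub_sub, ← smul_sub, map_smul, ← map_sub]
    simp

/-- The primitive of the difference of two mild solutions solves `W' = LW` with `W 0 = 0`, so it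
vanishes, and so does its derivative. -/
theorem IsGenerator.mildSolution_unique [CompleteSpace F] (hV : IsC0Semigroup V)
    (hL : IsGenerator V L) {f : F} {u : ℝ → F} (hu : IsMildSolution L f u) {t : ℝ}
    (ht : 0 ≤ t) : u t = V t f := by
  have hc := hu.1.sub (hV.continuousOn f)
  have hd : ∀ t, 0 ≤ t → HasDerivWithinAt (fun t => ∫ s in (0 : ℝ)..t, (u s - V s f))
      (u t - V t f) (Ici 0) t := fun t ht => hasDerivWithinAt_integral_Ici hc ht
  have hz : ∀ t : ℝ, 0 ≤ t → ∫ s in (0 : ℝ)..t, (u s - V s f) = 0 := fun t ht =>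
    hL.eq_zero_of_hasDerivWithinAt hV (W := fun t => ∫ s in (0 : ℝ)..t, (u s - V s f))
      (by simp) (fun t ht => (hd t ht).continuousWithinAt)
      (fun t ht => (hd t ht).mono (Ioi_subset_Ici ht)) (fun t ht => by
        have := L.graph.sub_mem (hu.2 t ht) (hL.integral_mem_graph hV ht f)
        rw [intervalIntegral.integral_sub
          (intervalIntegrable_of_continuousOn_Ici hu.1 le_rfl ht)
          (intervalIntegrable_of_continuousOn_Ici (hV.continuousOn f) le_rfl ht)]
        simpa using this) ht
  have h1 : HasDerivWithinAt (fun t => ∫ s in (0 : ℝ)..t, (u s - V s f)) 0 (Ici 0) t :=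
    (hasDerivWithinAt_const t (Ici 0) (0 : F)).congr hz (hz t ht)
  exact sub_eq_zero.1 ((uniqueDiffOn_Ici (0 : ℝ) t ht).eq_deriv _ (hd t ht) h1)

end Semigroup

/-! ### Chernoff's theorem through discrete resolvents -/

section Chernoff

/-- A bounded family of operators which converges to zero on a set converges to zero uniformly on
the compact subsets of its closure. -/
theorem eventually_norm_le_on_compact {ι E F : Type*} [NormedAddCommGroup E] [NormedSpace ℝ E]
    [NormedAddCommGroup F] [NormedSpace ℝ F] {l : Filter ι} {A : ι → E →L[ℝ] F} {C : ℝ}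
    (hA : ∀ᶠ i in l, ‖A i‖ ≤ C) {G K : Set E}
    (hG : ∀ p ∈ G, Tendsto (fun i => A i p) l (𝓝 0)) (hK : IsCompact K) (hKG : K ⊆ closure G)
    {ε : ℝ} (hε : 0 < ε) : ∀ᶠ i in l, ∀ p ∈ K, ‖A i p‖ ≤ ε := by
  refine hK.induction_on (p := fun s => ∀ᶠ i in l, ∀ p ∈ s, ‖A i p‖ ≤ ε) (by simp)
    (fun s t hst ht => ht.mono fun i hi p hp => hi p (hst hp))
    (fun s t hs ht => ?_) fun x hx => ?_
  · filter_upwards [hs, ht] with i h1 h2 p hp using hp.elim (h1 p) (h2 p)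
  -- The radius makes the bound on `A i (p - q)` equal to `ε / 2`; `|C| + 1` keeps the denominator
  -- positive.
  · obtain ⟨q, hq, hxq⟩ := Metric.mem_closure_iff.1 (hKG hx) (ε / (2 * (|C| + 1)))
      (by positivity)
    refine ⟨Metric.ball q (ε / (2 * (|C| + 1))),
      mem_nhdsWithin_of_mem_nhds (Metric.isOpen_ball.mem_nhds hxq), ?_⟩
    have hq0 : ∀ᶠ i in l, ‖A i q‖ < ε / 2 := by
      have := (hG q hq).norm
      rw [norm_zero] at this
      exact this.eventually_lt_const (by positivity)
    filter_upwards [hA, hq0] with i hi hiq p hp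
    have h1 : ‖A i (p - q)‖ ≤ (|C| + 1) * (ε / (2 * (|C| + 1))) :=
      ((A i).le_of_opNorm_le (hi.trans ((le_abs_self C).trans (le_add_of_nonneg_right zero_le_one))) _).trans
        (by gcongr; exact (mem_ball_iff_norm.1 hp).le)
    have h2 : (|C| + 1) * (ε / (2 * (|C| + 1))) = ε / 2 := by field_simp
    calc ‖A i p‖ = ‖A i (p - q) + A i q‖ := by rw [← map_add, sub_add_cancel]
      _ ≤ ε / 2 + ε / 2 := (norm_add_le _ _).trans (by linarith)
      _ = ε := by ring

variable {F : Type*} [NormedAddCommGroup F] [NormedSpace ℝ F]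

/-- The inverse of `z - (B - 1)/h`. -/
theorem exists_discrete_resolvent [CompleteSpace F] (B : F →L[ℝ] F) {h c z : ℝ} (hh : 0 < h) (hc : 0 ≤ c)
    (hz : c < z) (hB : ‖B‖ ≤ 1 + c * h) :
    ∃ R : F →L[ℝ] F, (∀ f, B (R f) = (1 + z * h) • R f - h • f) ∧
      (∀ f, R (B f) = (1 + z * h) • R f - h • f) ∧ ‖R‖ ≤ (z - c)⁻¹ := by
  have hz0 : 0 < z := hc.trans_lt hz
  have hp : 0 < 1 + z * h := by positivity
  -- Neumann series: `z - (B - 1) / h` is `(1 + z h) / h` times `1 - (1 + z h)⁻¹ B`.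
  have hX : ‖(1 + z * h)⁻¹ • B‖ < 1 := by
    rw [norm_smul, norm_inv, Real.norm_of_nonneg hp.le, inv_mul_lt_one₀ hp]
    exact hB.trans_lt (by gcongr)
  obtain ⟨U, hU⟩ := isUnit_one_sub_of_norm_lt_one hX
  have h1 : ∀ f, U.1 (U⁻¹.1 f) = f := fun f => by
    rw [← mul_apply_eq_comp, Units.mul_inv]; rfl
  have h2 : ∀ f, U⁻¹.1 (U.1 f) = f := fun f => by
    rw [← mul_apply_eq_comp, Units.inv_mul]; rfl
  have hBU : ∀ f, B f = (1 + z * h) • (f - U.1 f) := fun f => by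
    rw [hU]
    simp [hp.ne']
  have key : ∀ f, B (((1 + z * h)⁻¹ * h) • U⁻¹.1 f) =
      (1 + z * h) • ((1 + z * h)⁻¹ * h) • U⁻¹.1 f - h • f := fun f => by
    rw [hBU, map_smul, h1, smul_sub, smul_smul _ _ f, mul_inv_cancel_left₀ hp.ne']
  refine ⟨((1 + z * h)⁻¹ * h) • U⁻¹.1, key, fun f => ?_, ?_⟩
  · simp only [smul_apply]
    rw [hBU, map_smul, map_sub, h2, smul_comm _ (1 + z * h), smul_sub, smul_sub,
      smul_smul _ _ f, mul_inv_cancel_left₀ hp.ne']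
  · set R := ((1 + z * h)⁻¹ * h) • U⁻¹.1
    have e : (1 + z * h) • R = B * R + h • 1 := by
      ext f
      have := key f
      simp only [add_apply, mul_apply_eq_comp,
        smul_apply, one_apply_eq_self]
      rw [show R f = ((1 + z * h)⁻¹ * h) • U⁻¹.1 f from rfl, this]
      abel
    -- Taking norms in `(1 + z h) R = B R + h` leaves `(z - c) h ‖R‖ ≤ h`, a bound independent of
    -- `h`.
    have h3 : (1 + z * h) * ‖R‖ ≤ (1 + c * h) * ‖R‖ + h := by
      calc (1 + z * h) * ‖R‖ = ‖(1 + z * h) • R‖ := by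
            rw [norm_smul _ R, Real.norm_of_nonneg hp.le]
        _ ≤ ‖B‖ * ‖R‖ + h * ‖(1 : F →L[ℝ] F)‖ := by
            rw [e]
            refine (norm_add_le _ _).trans (add_le_add (norm_mul_le _ _) ?_)
            rw [norm_smul, Real.norm_of_nonneg hh.le]
        _ ≤ (1 + c * h) * ‖R‖ + h * 1 := by
            gcongr
            exact ContinuousLinearMap.norm_id_le
        _ = _ := by ring
    rw [← one_div, le_div_iff₀ (sub_pos.2 hz)]
    refine le_of_mul_le_mul_left ?_ hh
    linarith

theorem norm_pow_apply_le (B : F →L[ℝ] F) {h c : ℝ} (hB : ‖B‖ ≤ 1 + c * h) (n : ℕ) (f : F) :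
    ‖(B ^ n) f‖ ≤ (1 + c * h) ^ n * ‖f‖ := by
  induction n with
  | zero => simp
  | succ n ih =>
    rw [pow_succ', mul_apply_eq_comp]
    refine (B.le_of_opNorm_le hB _).trans ?_
    rw [pow_succ', mul_assoc]
    exact mul_le_mul_of_nonneg_left ih ((norm_nonneg B).trans hB)

/-- Stability and consistency along a discrete curve give closeness. -/
theorem norm_pow_sub_le (B : F →L[ℝ] F) {h c η : ℝ} (hh : 0 ≤ h) (hc : 0 ≤ c) (hη : 0 ≤ η)
    (hB : ‖B‖ ≤ 1 + c * h) (w : ℕ → F) {n : ℕ}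
    (hw : ∀ k < n, ‖w (k + 1) - B (w k)‖ ≤ h * η) :
    ‖(B ^ n) (w 0) - w n‖ ≤ (1 + c * h) ^ n * (n * (h * η)) := by
  induction n with
  | zero => simp
  | succ n ih =>
    have ih := ih fun k hk => hw k (hk.trans (Nat.lt_succ_self n))
    have e : (B ^ (n + 1)) (w 0) - w (n + 1) =
        B ((B ^ n) (w 0) - w n) - (w (n + 1) - B (w n)) := by
      rw [pow_succ', mul_apply_eq_comp, map_sub]
      abel
    have h1 : 1 ≤ 1 + c * h := le_add_of_nonneg_right (by positivity)
    rw [e]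
    calc _ ≤ ‖B ((B ^ n) (w 0) - w n)‖ + ‖w (n + 1) - B (w n)‖ := norm_sub_le _ _
      _ ≤ (1 + c * h) * ((1 + c * h) ^ n * (n * (h * η))) + h * η :=
        add_le_add ((B.le_of_opNorm_le hB _).trans
          (mul_le_mul_of_nonneg_left ih (by positivity))) (hw n (Nat.lt_succ_self n))
      _ ≤ (1 + c * h) * ((1 + c * h) ^ n * (n * (h * η))) + (1 + c * h) ^ (n + 1) * (h * η) := by
        refine add_le_add_right ?_ _
        exact le_mul_of_one_le_left (mul_nonneg hh hη) (one_le_pow₀ h1)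
      _ = _ := by push_cast; ring

theorem one_add_div_pow_le_exp {c t T : ℝ} (hc : 0 ≤ c) (ht : t ∈ Icc 0 T) {n : ℕ} (hn : 0 < n) :
    (1 + c * (t / n)) ^ n ≤ Real.exp (c * T) := by
  have hn' : (0 : ℝ) < n := by exact_mod_cast hn
  have h0 : 0 ≤ c * (t / n) := mul_nonneg hc (div_nonneg ht.1 hn'.le)
  calc (1 + c * (t / n)) ^ n ≤ (Real.exp (c * (t / n))) ^ n := by
        gcongr
        rw [add_comm]
        exact Real.add_one_le_exp _
    _ = Real.exp (c * t) := by
        rw [← Real.exp_nat_mul]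
        congr 1
        field_simp
    _ ≤ _ := Real.exp_le_exp.2 (mul_le_mul_of_nonneg_left ht.2 hc)

/-- One threshold `n > T / δ` serves all `t ≤ T`. The endpoint `t = 0` is left out because `P` is
known only for positive steps. -/
theorem eventually_forall_div_of_eventually {P : ℝ → Prop} (hP : ∀ᶠ h in 𝓝[>] (0 : ℝ), P h)
    (T : ℝ) : ∀ᶠ n : ℕ in atTop, ∀ t ∈ Ioc 0 T, P (t / n) := by
  obtain ⟨δ, hδ, hP⟩ := mem_nhdsGT_iff_exists_Ioo_subset.1 hP
  have hδ : 0 < δ := hδ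
  filter_upwards [tendsto_natCast_atTop_atTop.eventually_gt_atTop (T / δ),
    eventually_gt_atTop 0] with n hn hn0 t ht
  have hn' : (0 : ℝ) < n := by exact_mod_cast hn0
  refine hP ⟨div_pos ht.1 hn', ?_⟩
  rw [div_lt_iff₀ hδ] at hn
  rw [div_lt_iff₀ hn', mul_comm]
  exact ht.2.trans_lt hn

variable {V S : ℝ → F →L[ℝ] F} {L : F →ₗ.[ℝ] F} {c : ℝ} {G : Set (F × F)}

/-- Convergence of the discrete resolvents along orbits in the domain of the generator. -/
theorem eventually_resolvent_orbit (hV : IsC0Semigroup V) (hL : IsGenerator V L)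
    (hG : ∀ p ∈ G, Tendsto (fun h : ℝ => h⁻¹ • (S h p.1 - p.1)) (𝓝[>] 0) (𝓝 p.2))
    (hLG : (L.graph : Set (F × F)) ⊆ closure G) {z C : ℝ} {R : ℝ → F →L[ℝ] F}
    (hR : ∀ h, 0 < h → (∀ f, R h (S h f) = (1 + z * h) • R h f - h • f) ∧ ‖R h‖ ≤ C)
    {f g : F} (hfg : (f, g) ∈ L.graph) (T : ℝ) {ε : ℝ} (hε : 0 < ε) :
    ∀ᶠ h in 𝓝[>] (0 : ℝ), ∀ s ∈ Icc 0 T, ‖R h (z • V s f - V s g) - V s f‖ ≤ ε := by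
  -- The error is viewed as a bounded operator on pairs `(f, Lf)`, so that density of `G` in the
  -- graph can be used in the product norm.
  let Z : F × F →L[ℝ] F := z • ContinuousLinearMap.fst ℝ F F - ContinuousLinearMap.snd ℝ F F
  have hC : 0 ≤ C := (norm_nonneg _).trans (hR 1 one_pos).2
  have hA : ∀ᶠ h in 𝓝[>] (0 : ℝ), ‖(R h).comp Z - ContinuousLinearMap.fst ℝ F F‖ ≤
      C * ‖Z‖ + 1 := by
    filter_upwards [self_mem_nhdsWithin] with h hh
    refine (norm_sub_le _ _).trans (add_le_add ?_ (ContinuousLinearMap.norm_fst_le ..))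
    exact (ContinuousLinearMap.opNorm_comp_le _ _).trans (by gcongr; exact (hR h hh).2)
  have hG' : ∀ p ∈ G, Tendsto (fun h => ((R h).comp Z - ContinuousLinearMap.fst ℝ F F) p)
      (𝓝[>] (0 : ℝ)) (𝓝 0) := by
    intro p hp
    have h1 : Tendsto (fun h : ℝ => C * ‖h⁻¹ • (S h p.1 - p.1) - p.2‖) (𝓝[>] 0) (𝓝 0) := by
      simpa using ((tendsto_sub_nhds_zero_iff.2 (hG p hp)).norm).const_mul C
    refine squeeze_zero_norm' ?_ h1
    filter_upwards [self_mem_nhdsWithin] with h hh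
    have e : ((R h).comp Z - ContinuousLinearMap.fst ℝ F F) p =
        R h (h⁻¹ • (S h p.1 - p.1) - p.2) := by
      have hh0 : h ≠ 0 := ne_of_gt hh
      have e0 : ((R h).comp Z - ContinuousLinearMap.fst ℝ F F) p =
        R h (z • p.1 - p.2) - p.1 := rfl
      rw [e0, map_sub, map_sub, map_smul, map_smul, map_sub, (hR h hh).1]
      have e1 : h⁻¹ • ((1 + z * h) • R h p.1 - h • p.1 - R h p.1) = z • R h p.1 - p.1 := by
        rw [add_smul, one_smul, add_sub_assoc, add_sub_cancel_left, smul_sub, smul_smul, smul_smul,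
          inv_mul_cancel₀ hh0, one_smul, mul_comm z, inv_mul_cancel_left₀ hh0]
      rw [e1]
      abel
    rw [e]
    exact (R h).le_of_opNorm_le (hR h hh).2 _
  have hK : IsCompact ((fun s => (V s f, V s g)) '' Icc 0 T) :=
    isCompact_Icc.image_of_continuousOn
      (((hV.continuousOn f).prodMk (hV.continuousOn g)).mono Icc_subset_Ici_self)
  have := eventually_norm_le_on_compact hA hG' hK (by
    rintro _ ⟨s, hs, rfl⟩
    exact hLG (hL.map_mem_graph hV hs.1 hfg)) hε
  filter_upwards [this] with h hh s hs using hh _ (mem_image_of_mem _ hs)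

/-- Chernoff approximation for initial data in the domain of the square of the generator. -/
theorem eventually_norm_pow_sub_le_of_mem_domain_sq [CompleteSpace F] (hV : IsC0Semigroup V) (hL : IsGenerator V L)
    (hG : ∀ p ∈ G, Tendsto (fun h : ℝ => h⁻¹ • (S h p.1 - p.1)) (𝓝[>] 0) (𝓝 p.2))
    (hLG : (L.graph : Set (F × F)) ⊆ closure G)
    (hc : 0 ≤ c) (hS0 : S 0 = 1) (hS : ∀ h, 0 ≤ h → ‖S h‖ ≤ 1 + c * h)
    {f f' f'' : F} (hf : (f, f') ∈ L.graph) (hf' : (f', f'') ∈ L.graph)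
    {T : ℝ} (hT : 0 ≤ T) {ε : ℝ} (hε : 0 < ε) :
    ∀ᶠ n : ℕ in atTop, ∀ t ∈ Icc 0 T, ‖(S (t / n) ^ n) f - V t f‖ ≤ ε := by
  have hR : ∀ h : ℝ, 0 < h → ∃ R : F →L[ℝ] F,
      (∀ f, S h (R f) = (1 + (c + 1) * h) • R f - h • f) ∧
      (∀ f, R (S h f) = (1 + (c + 1) * h) • R f - h • f) ∧ ‖R‖ ≤ 1 := fun h hh => by
    simpa using exists_discrete_resolvent (S h) hh hc (lt_add_one c) (hS h hh.le)
  choose! R hR1 hR2 hR3 using hR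
  set z := c + 1
  obtain ⟨M, hM0, hM⟩ := hV.exists_bound T
  set E := Real.exp (c * T)
  have hE : 0 < E := Real.exp_pos _
  -- The three errors below are at most `E η`, `E T η` and `η`.
  set η := ε / (E + E * T + 1) with hηd
  have hη : 0 < η := by positivity
  -- Here `g = (z - L) f`; it lies in the domain of `L` because `f` lies in that of `L²`, so
  -- resolvent convergence also applies along the orbit of `g`.
  set g := z • f - f' with hg
  have hgg : (g, z • f' - f'') ∈ L.graph := L.graph.sub_mem (L.graph.smul_mem z hf) hf'
  set g' := z • f' - f''
  have c1 := eventually_resolvent_orbit hV hL hG hLG (fun h hh => ⟨hR2 h hh, hR3 h hh⟩) hf T hη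
  have c2 := eventually_resolvent_orbit hV hL hG hLG (fun h hh => ⟨hR2 h hh, hR3 h hh⟩) hgg T
    (half_pos hη)
  have c3 : ∀ᶠ h in 𝓝[>] (0 : ℝ), M * ‖h⁻¹ • (V h g - g) - g'‖ < η / 2 := by
    have : Tendsto (fun h : ℝ => M * ‖h⁻¹ • (V h g - g) - g'‖) (𝓝[>] 0) (𝓝 0) := by
      simpa using ((tendsto_sub_nhds_zero_iff.2 ((hL _ _).1 hgg)).norm).const_mul M
    exact this.eventually_lt_const (half_pos hη)
  filter_upwards [eventually_forall_div_of_eventually (c1.and (c2.and c3)) T,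
    eventually_gt_atTop 0] with n hn hn0 t ht
  rcases ht.1.eq_or_lt with rfl | ht0
  · simp [hS0, hV.zero_apply, hε.le]
  obtain ⟨k1, k2, k3⟩ := hn t ⟨ht0, ht.2⟩
  have hn' : (0 : ℝ) < n := by exact_mod_cast hn0
  have hpow := one_add_div_pow_le_exp hc ht hn0
  have hnt : (n : ℝ) * (t / n) = t := mul_div_cancel₀ t hn'.ne'
  set h := t / n
  have hh : 0 < h := div_pos ht0 hn'
  have horb : ∀ s ∈ Icc 0 T, ‖R h (V s g) - V s f‖ ≤ η := fun s hs => by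
    simpa [hg] using k1 s hs
  let w : ℕ → F := fun k => R h (V (k * h) g)
  have hw : ∀ k < n, ‖w (k + 1) - S h (w k)‖ ≤ h * η := fun k hk => by
    have hk0 : 0 ≤ k * h := by positivity
    have hkT : k * h ≤ T := by
      refine le_trans ?_ (hnt.le.trans ht.2)
      gcongr
    have hks : (k * h) ∈ Icc 0 T := ⟨hk0, hkT⟩
    -- The defect splits into the consistency error of `V` at `g` and the resolvent error along the
    -- orbit of `g`, each at most `η / 2` after division by `h`.
    have e : w (k + 1) - S h (w k) = h • (R h (V (k * h) (h⁻¹ • (V h g - g) - g')) -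
        (R h (z • V (k * h) g - V (k * h) g') - V (k * h) g)) := by
      simp only [w]
      rw [hR1 h hh, Nat.cast_succ, add_one_mul, hV.add_apply hk0 hh.le]
      simp only [map_sub, map_smul, smul_sub, smul_smul, mul_inv_cancel₀ hh.ne', one_smul,
        add_smul, mul_comm z h]
      abel
    rw [e, norm_smul, Real.norm_of_nonneg hh.le]
    gcongr
    refine (norm_sub_le _ _).trans ?_
    have h1 : ‖R h (V (k * h) (h⁻¹ • (V h g - g) - g'))‖ ≤ M * ‖h⁻¹ • (V h g - g) - g'‖ :=
      ((R h).le_of_opNorm_le (hR3 h hh) _).trans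
        (by rw [one_mul]; exact (V (k * h)).le_of_opNorm_le (hM _ hks) _)
    linarith [k2 _ hks]
  have b1 : ‖(S h ^ n) (f - w 0)‖ ≤ E * η := by
    refine (norm_pow_apply_le (S h) (hS h hh.le) n _).trans ?_
    gcongr
    rw [norm_sub_rev]
    simpa [w, hV.zero_apply] using horb 0 ⟨le_rfl, hT⟩
  have b2 : ‖(S h ^ n) (w 0) - w n‖ ≤ E * (T * η) := by
    refine (norm_pow_sub_le (S h) hh.le hc hη.le (hS h hh.le) w hw).trans ?_
    rw [← mul_assoc (n : ℝ), hnt]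
    gcongr
    exact ht.2
  have b3 : ‖w n - V t f‖ ≤ η := by
    simp only [w]
    rw [hnt]
    exact horb t ht
  calc ‖(S h ^ n) f - V t f‖
      = ‖(S h ^ n) (f - w 0) + ((S h ^ n) (w 0) - w n) + (w n - V t f)‖ := by
        rw [map_sub]; congr 1; abel
    _ ≤ E * η + E * (T * η) + η :=
        norm_add₃_le.trans (add_le_add (add_le_add b1 b2) b3)
    _ = (E + E * T + 1) * η := by ring
    _ = ε := by rw [hηd]; field_simp

/-- Averaging an orbit over a short time lands in the domain of `L`. Averaging twice lands in that
of `L²`, since `L` sends the second average to `h⁻¹ (V h v - v)` with `v` already in the domain. -/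
theorem IsGenerator.exists_mem_domain_sq [CompleteSpace F] (hV : IsC0Semigroup V) (hL : IsGenerator V L) (u : F)
    {ε : ℝ} (hε : 0 < ε) :
    ∃ f f' f'', (f, f') ∈ L.graph ∧ (f', f'') ∈ L.graph ∧ ‖f - u‖ < ε := by
  have key : ∀ v : F, ∃ h : ℝ, 0 < h ∧ ‖(h⁻¹ • ∫ s in (0 : ℝ)..h, V s v) - v‖ < ε / 2 :=
    fun v => by
      have h1 := ((tendsto_sub_nhds_zero_iff.2 (hV.tendsto_average v)).norm)
      rw [norm_zero] at h1
      obtain ⟨h, hh, h0⟩ := ((h1.eventually_lt_const (half_pos hε)).and self_mem_nhdsWithin).exists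
      exact ⟨h, h0, hh⟩
  obtain ⟨r, hr, hru⟩ := key u
  have m1 := L.graph.smul_mem r⁻¹ (hL.integral_mem_graph hV hr.le u)
  rw [Prod.smul_mk] at m1
  set v := r⁻¹ • ∫ s in (0 : ℝ)..r, V s u
  obtain ⟨h, hh, hhv⟩ := key v
  refine ⟨_, _, _, L.graph.smul_mem h⁻¹ (hL.integral_mem_graph hV hh.le v),
    L.graph.smul_mem h⁻¹ (L.graph.sub_mem (hL.map_mem_graph hV hh.le m1) m1), ?_⟩
  have := norm_add_le ((h⁻¹ • ∫ s in (0 : ℝ)..h, V s v) - v) (v - u)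
  rw [sub_add_sub_cancel] at this
  exact this.trans_lt (by linarith)

/-- **Chernoff's theorem.** -/
theorem tendstoUniformlyOn_pow_of_consistent [CompleteSpace F] (hV : IsC0Semigroup V) (hL : IsGenerator V L)
    (hG : ∀ p ∈ G, Tendsto (fun h : ℝ => h⁻¹ • (S h p.1 - p.1)) (𝓝[>] 0) (𝓝 p.2))
    (hLG : (L.graph : Set (F × F)) ⊆ closure G)
    (hc : 0 ≤ c) (hS0 : S 0 = 1) (hS : ∀ h, 0 ≤ h → ‖S h‖ ≤ 1 + c * h)
    (u : F) {T : ℝ} (hT : 0 ≤ T) :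
    TendstoUniformlyOn (fun (n : ℕ) (t : ℝ) => (S (t / n) ^ n) u) (fun t => V t u) atTop
      (Icc 0 T) := by
  rw [Metric.tendstoUniformlyOn_iff]
  intro ε hε
  obtain ⟨M, hM0, hM⟩ := hV.exists_bound T
  set E := Real.exp (c * T)
  have hE : 0 < E := Real.exp_pos _
  obtain ⟨f, f', f'', hf, hf', hfu⟩ := hL.exists_mem_domain_sq hV u
    (show 0 < ε / (2 * (E + M)) by positivity)
  filter_upwards [eventually_norm_pow_sub_le_of_mem_domain_sq hV hL hG hLG hc hS0 hS hf hf' hT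
    (show 0 < ε / 4 by positivity), eventually_gt_atTop 0] with n hn hn0 t ht
  have b1 : ‖(S (t / n) ^ n) (u - f)‖ ≤ E * ‖f - u‖ := by
    rw [norm_sub_rev f]
    exact (norm_pow_apply_le _ (hS _ (div_nonneg ht.1 n.cast_nonneg)) n _).trans
      (mul_le_mul_of_nonneg_right (one_add_div_pow_le_exp hc ht hn0) (norm_nonneg _))
  have b2 : ‖V t (f - u)‖ ≤ M * ‖f - u‖ := (V t).le_of_opNorm_le (hM t ht) _
  have b3 : (E + M) * ‖f - u‖ < ε / 2 := by
    calc _ < (E + M) * (ε / (2 * (E + M))) := by gcongr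
      _ = ε / 2 := by field_simp
  rw [dist_comm, dist_eq_norm]
  calc ‖(S (t / n) ^ n) u - V t u‖
      = ‖(S (t / n) ^ n) (u - f) + ((S (t / n) ^ n) f - V t f) + V t (f - u)‖ := by
        rw [map_sub, map_sub]; congr 1; abel
    _ ≤ E * ‖f - u‖ + ε / 4 + M * ‖f - u‖ :=
        norm_add₃_le.trans (add_le_add (add_le_add b1 (hn t ht)) b2)
    _ < ε := by linarith

end Chernoff

/-! ### Taylor estimates and consistency of `S(t)` with `H` -/

section Consistency

/-- The mean value inequality in a form that can be iterated: each use raises the order of vanishing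
by one. The constant is not sharp. -/
theorem abs_sub_le_of_abs_deriv_le {f f' : ℝ → ℝ} (hd : ∀ s, HasDerivAt f (f' s) s) {C : ℝ}
    {k : ℕ} (hb : ∀ s, |f' s| ≤ C * |s| ^ k) (h : ℝ) : |f h - f 0| ≤ C * |h| ^ (k + 1) := by
  have hC : 0 ≤ C := (abs_nonneg _).trans (by simpa using hb 1)
  have := (convex_uIcc (0 : ℝ) h).norm_image_sub_le_of_norm_hasDerivWithin_le
    (fun s _ => (hd s).hasDerivWithinAt) (C := C * |h| ^ k) (fun s hs => (hb s).trans (by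
      have h1 : |s| ≤ |h| := by simpa using abs_sub_left_of_mem_uIcc hs
      gcongr)) left_mem_uIcc right_mem_uIcc
  rw [pow_succ, ← mul_assoc]
  simpa using this

/-- Taylor estimate for the symmetric second difference. -/
theorem abs_second_difference_sub_le {f f₁ f₂ f₃ : ℝ → ℝ} (h₁ : ∀ s, HasDerivAt f (f₁ s) s)
    (h₂ : ∀ s, HasDerivAt f₁ (f₂ s) s) (h₃ : ∀ s, HasDerivAt f₂ (f₃ s) s) {C : ℝ}
    (hC : ∀ s, |f₃ s| ≤ C) (h : ℝ) :
    |f h + f (-h) - 2 * f 0 - h ^ 2 * f₂ 0| ≤ 2 * C * |h| ^ 3 := by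
  have b2 := abs_sub_le_of_abs_deriv_le h₃ (k := 0) (by simpa using hC)
  have b1 := abs_sub_le_of_abs_deriv_le (f := fun s => f₁ s - s * f₂ 0)
    (f' := fun s => f₂ s - f₂ 0) (fun s => by
      simpa using HasDerivAt.fun_sub (h₂ s) (hasDerivAt_mul_const (x := s) (f₂ 0))) b2
  -- This is the second-order Taylor remainder; adding its values at `h` and `-h` cancels the linear
  -- terms.
  have b0 := abs_sub_le_of_abs_deriv_le (f := fun s => f s - s * f₁ 0 - s ^ 2 * (f₂ 0 / 2))
    (f' := fun s => f₁ s - s * f₂ 0 - f₁ 0) (fun s => by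
      refine HasDerivAt.congr_deriv (((h₁ s).sub (hasDerivAt_mul_const (x := s) (f₁ 0))).sub
        ((hasDerivAt_pow 2 s).mul_const (f₂ 0 / 2))) ?_
      push_cast
      ring) (k := 2) (fun s => by
      rw [show f₁ s - s * f₂ 0 - f₁ 0 = f₁ s - s * f₂ 0 - (f₁ 0 - 0 * f₂ 0) by ring]
      exact b1 s)
  have e1 := b0 h
  have e2 := b0 (-h)
  rw [abs_neg] at e2
  simp only [zero_mul, sub_zero, ne_eq, OfNat.ofNat_ne_zero, not_false_eq_true, zero_pow] at e1 e2
  rw [show f h + f (-h) - 2 * f 0 - h ^ 2 * f₂ 0 =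
    (f h - h * f₁ 0 - h ^ 2 * (f₂ 0 / 2) - f 0) +
      (f (-h) - -h * f₁ 0 - (-h) ^ 2 * (f₂ 0 / 2) - f 0) by ring]
  exact (abs_add_le _ _).trans (by linarith)

theorem IsCbInfty.hasDerivAt_line {d : ℕ} {φ : Rd d → ℝ} (hφ : IsCbInfty φ) (j : Fin d)
    (x : Rd d) (s : ℝ) :
    HasDerivAt (fun s : ℝ => φ (x + s • stdVec j))
      (DiffusionSemigroup.partialD j φ (x + s • stdVec j)) s := by
  have h1 : HasDerivAt (fun s : ℝ => x + s • stdVec j) (stdVec j) s := by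
    simpa using ((hasDerivAt_id s).smul_const (stdVec j)).const_add x
  exact (hφ.differentiable _).hasFDerivAt.comp_hasDerivAt s h1

theorem IsCbInfty.exists_second_difference_le {d : ℕ} {φ : Rd d → ℝ} (hφ : IsCbInfty φ)
    (j : Fin d) : ∃ C : ℝ, 0 ≤ C ∧ ∀ x : Rd d, ∀ h : ℝ,
      |φ (x + h • stdVec j) + φ (x - h • stdVec j) - 2 * φ x -
        h ^ 2 * DiffusionSemigroup.partialD j (DiffusionSemigroup.partialD j φ) x| ≤
        C * |h| ^ 3 := by
  obtain ⟨C, hC⟩ := (((hφ.partialD j).partialD j).partialD j).isBUC.1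
  refine ⟨2 * C, by linarith [(abs_nonneg _).trans (hC 0)], fun x h => ?_⟩
  simpa [sub_eq_add_neg] using abs_second_difference_sub_le (fun s => hφ.hasDerivAt_line j x s)
    (fun s => (hφ.partialD j).hasDerivAt_line j x s)
    (fun s => ((hφ.partialD j).partialD j).hasDerivAt_line j x s) (fun s => hC _) h

/-- A bounded second derivative makes `fderiv ℝ φ` Lipschitz; the mean value inequality on the ball
of radius `‖v‖` then gives the quadratic remainder. -/
theorem IsCbInfty.exists_first_order_le {d : ℕ} {φ : Rd d → ℝ} (hφ : IsCbInfty φ) :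
    ∃ C : ℝ, 0 ≤ C ∧ ∀ x v : Rd d, |φ (x + v) - φ x - fderiv ℝ φ x v| ≤ C * ‖v‖ ^ 2 := by
  obtain ⟨C, hC⟩ := hφ.2 2
  have hC0 : 0 ≤ C := (norm_nonneg _).trans (hC 0)
  have hd : Differentiable ℝ (fderiv ℝ φ) :=
    (hφ.1.fderiv_right (m := ∞) (by simp)).differentiable (by simp)
  have hlip : ∀ x y, ‖fderiv ℝ φ y - fderiv ℝ φ x‖ ≤ C * ‖y - x‖ := fun x y =>
    convex_univ.norm_image_sub_le_of_norm_fderiv_le (fun z _ => hd z) (fun z _ => by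
      have := hC z
      rwa [← norm_iteratedFDeriv_fderiv, norm_iteratedFDeriv_one] at this)
      (mem_univ x) (mem_univ y)
  refine ⟨C, hC0, fun x v => ?_⟩
  have := (convex_closedBall x ‖v‖).norm_image_sub_le_of_norm_fderiv_le' (𝕜 := ℝ) (f := φ)
    (φ := fderiv ℝ φ x) (x := x) (y := x + v) (C := C * ‖v‖) (fun z _ => hφ.differentiable z)
    (fun z hz => (hlip x z).trans (by gcongr; exact mem_closedBall_iff_norm.1 hz))
    (by simp) (by simp)
  rw [add_sub_cancel_left] at this
  rw [pow_two, ← mul_assoc]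
  exact this

theorem vecB_eq_sum {d : ℕ} (b : Fin d → UCb d) (x : Rd d) :
    vecB b x = ∑ j, (b j x) • stdVec j := by
  ext i
  simp [vecB, stdVec, Pi.single_apply]

theorem norm_vecB_le {d : ℕ} (b : Fin d → UCb d) (x : Rd d) : ‖vecB b x‖ ≤ ∑ j, ‖b j‖ := by
  rw [vecB_eq_sum]
  refine (norm_sum_le _ _).trans (Finset.sum_le_sum fun j _ => ?_)
  rw [norm_smul, stdVec, PiLp.norm_single]
  simpa using (b j).abs_apply_le x

theorem fderiv_vecB {d : ℕ} (b : Fin d → UCb d) (φ : Rd d → ℝ) (x : Rd d) :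
    fderiv ℝ φ x (vecB b x) = ∑ j, b j x * partialD j φ x := by
  simp [vecB_eq_sum, partialD]

/-- `S(t)φ = φ + tHφ + o(t)` for `φ ∈ C_b^∞`, with an explicit rate. -/
theorem exists_abs_transExpr_sub_le {d : ℕ} (hd : 1 ≤ d) (a b : Fin d → UCb d) (c : UCb d)
    {φ : Rd d → ℝ} (hφ : IsCbInfty φ) : ∃ K₁ K₂ : ℝ, 0 ≤ K₁ ∧ 0 ≤ K₂ ∧ ∀ t : ℝ, 0 ≤ t → ∀ x,
      |transExpr a b c t φ x - φ x - t * diffExpr a b c φ x| ≤ t * (K₁ * √t + K₂ * t) := by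
  choose C hC0 hC using hφ.exists_second_difference_le
  obtain ⟨D, hD0, hD⟩ := hφ.exists_first_order_le
  have hd0 : (0 : ℝ) < d := by exact_mod_cast hd
  have hB : 0 ≤ ∑ j, ‖b j‖ := Finset.sum_nonneg fun j _ => norm_nonneg _
  refine ⟨1 / (4 * (d : ℝ)) * ∑ j, C j * (2 * √(d : ℝ) * ‖a j‖) ^ 3, 2 * D * (∑ j, ‖b j‖) ^ 2,
    mul_nonneg (by positivity) (Finset.sum_nonneg fun j _ => mul_nonneg (hC0 j) (by positivity)),
    by positivity, fun t ht x => ?_⟩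
  set h : Fin d → ℝ := fun j => 2 * √(d : ℝ) * a j x * √t
  set e : Fin d → ℝ := fun j => φ (x + h j • stdVec j) + φ (x - h j • stdVec j) - 2 * φ x -
    h j ^ 2 * partialD j (partialD j φ) x
  set r : ℝ := φ (x + (2 * t) • vecB b x) - φ x - fderiv ℝ φ x ((2 * t) • vecB b x)
  -- The factor `2 √d` in the shift makes `h j ^ 2 / (4 d)` equal to `t (a j x) ^ 2`; likewise the
  -- weight `1 / 2` compensates for the shift `2 t b`.
  have hh2 : ∀ j, h j ^ 2 = 4 * d * t * a j x ^ 2 := fun j => by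
    simp only [h, mul_pow, Real.sq_sqrt hd0.le, Real.sq_sqrt ht]
    ring
  have hid : transExpr a b c t φ x - φ x - t * diffExpr a b c φ x =
      1 / (4 * (d : ℝ)) * ∑ j, e j + 1 / 2 * r := by
    have hs : ∑ j, (φ (x + h j • stdVec j) + φ (x - h j • stdVec j)) =
        ∑ j, e j + d * (2 * φ x) +
          4 * d * t * ∑ j, a j x ^ 2 * partialD j (partialD j φ) x := by
      have : ∀ j, φ (x + h j • stdVec j) + φ (x - h j • stdVec j) =
          e j + 2 * φ x + 4 * d * t * (a j x ^ 2 * partialD j (partialD j φ) x) := fun j => by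
        simp only [e, hh2]
        ring
      simp only [this, Finset.sum_add_distrib, ← Finset.mul_sum]
      simp
      ring
    have hr : φ (x + (2 * t) • vecB b x) =
        r + φ x + 2 * t * ∑ j, b j x * partialD j φ x := by
      simp only [r, map_smul, fderiv_vecB, smul_eq_mul]
      ring
    unfold transExpr diffExpr
    rw [hs, hr]
    field_simp
    ring
  -- A cubic remainder with shifts of size `√t` is of order `t √t`, uniformly in `x` because `a j`
  -- is bounded.
  have he : ∀ j, |e j| ≤ C j * (2 * √(d : ℝ) * ‖a j‖) ^ 3 * (t * √t) := fun j => by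
    refine (hC j x (h j)).trans ?_
    have hj : |h j| ≤ 2 * √(d : ℝ) * ‖a j‖ * √t := by
      simp only [h, abs_mul, abs_of_nonneg (Real.sqrt_nonneg _), abs_two]
      gcongr
      exact (a j).abs_apply_le x
    calc C j * |h j| ^ 3 ≤ C j * (2 * √(d : ℝ) * ‖a j‖ * √t) ^ 3 := by
          gcongr
          exact hC0 j
      _ = C j * (2 * √(d : ℝ) * ‖a j‖) ^ 3 * (√t ^ 2 * √t) := by ring
      _ = _ := by rw [Real.sq_sqrt ht]
  have hr : |r| ≤ 4 * D * (∑ j, ‖b j‖) ^ 2 * t ^ 2 := by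
    refine (hD x _).trans ?_
    rw [norm_smul, Real.norm_of_nonneg (by positivity)]
    calc D * (2 * t * ‖vecB b x‖) ^ 2 ≤ D * (2 * t * ∑ j, ‖b j‖) ^ 2 := by
          gcongr
          exact norm_vecB_le b x
      _ = _ := by ring
  rw [hid]
  calc |1 / (4 * (d : ℝ)) * ∑ j, e j + 1 / 2 * r|
      ≤ 1 / (4 * (d : ℝ)) * ∑ j, |e j| + 1 / 2 * |r| := by
        refine (abs_add_le _ _).trans ?_
        rw [abs_mul, abs_mul, abs_of_nonneg (by positivity : 0 ≤ 1 / (4 * (d : ℝ))),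
          abs_of_nonneg (by norm_num : (0 : ℝ) ≤ 1 / 2)]
        gcongr
        exact Finset.abs_sum_le_sum_abs _ _
    _ ≤ 1 / (4 * (d : ℝ)) * ∑ j, C j * (2 * √(d : ℝ) * ‖a j‖) ^ 3 * (t * √t) +
        1 / 2 * (4 * D * (∑ j, ‖b j‖) ^ 2 * t ^ 2) := by
        gcongr with j
        exact he j
    _ = _ := by
        rw [← Finset.sum_mul]
        ring

theorem tendsto_opS_sub_div {d : ℕ} (hd : 1 ≤ d) (a b : Fin d → UCb d) (c : UCb d)
    (φ : (opH a b c).domain) :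
    Tendsto (fun t : ℝ => t⁻¹ • (opS a b c t (φ : UCb d) - φ)) (𝓝[>] 0) (𝓝 (opH a b c φ)) := by
  obtain ⟨K₁, K₂, h1, h2, hK⟩ := exists_abs_transExpr_sub_le hd a b c
    (φ := fun x => (φ : UCb d) x) φ.2
  rw [← tendsto_sub_nhds_zero_iff]
  have hlim : Tendsto (fun t : ℝ => K₁ * √t + K₂ * t) (𝓝[>] 0) (𝓝 0) := by
    have : Continuous (fun t : ℝ => K₁ * √t + K₂ * t) := by fun_prop
    simpa using (this.tendsto 0).mono_left (nhdsWithin_le_nhds (s := Ioi 0))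
  refine squeeze_zero_norm' ?_ hlim
  filter_upwards [self_mem_nhdsWithin] with t ht
  have ht : 0 < t := ht
  refine (UCb.norm_le (by positivity)).2 fun x => ?_
  have e : (t⁻¹ • (opS a b c t (φ : UCb d) - φ) - opH a b c φ) x =
      t⁻¹ * (transExpr a b c t (fun x => (φ : UCb d) x) x - (φ : UCb d) x -
        t * diffExpr a b c (fun x => (φ : UCb d) x) x) := by
    rw [mul_sub, inv_mul_cancel_left₀ ht.ne']
    rfl
  rw [e, abs_mul, abs_of_pos (inv_pos.2 ht), inv_mul_le_iff₀ ht]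
  exact hK t ht.le x

theorem norm_opS_le {d : ℕ} (a b : Fin d → UCb d) (c : UCb d) {t : ℝ} (ht : 0 ≤ t) :
    ‖opS a b c t‖ ≤ 1 + ‖c‖ * t := by
  refine (LinearMap.mkContinuous_norm_le _ (by positivity) _).trans ?_
  rw [abs_of_nonneg ht, mul_comm]

/-- The weights sum to `2 d / (4 d) + 1 / 2 = 1`, which requires `d ≠ 0`. This covers `t = 0`, where
no discrete resolvent is available. -/
theorem opS_zero {d : ℕ} (hd : 1 ≤ d) (a b : Fin d → UCb d) (c : UCb d) : opS a b c 0 = 1 := by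
  ext f
  refine ucb_ext fun x => ?_
  change transExpr a b c 0 (fun x => f x) x = f x
  have hd0 : (d : ℝ) ≠ 0 := by positivity
  simp only [transExpr, Real.sqrt_zero, mul_zero, zero_smul, add_zero, sub_zero, zero_mul,
    Finset.sum_const, Finset.card_univ, Fintype.card_fin, nsmul_eq_mul]
  field_simp
  ring

end Consistency

end DiffusionSemigroup

/-! ### The Cauchy problem for the closure of `H` -/

theorem theorem3 (d : ℕ) (hd : 1 ≤ d)
    (a b : Fin d → UCb d) (c : UCb d)
    (hH : (opH a b c).IsClosable)
    (V : ℝ → UCb d →L[ℝ] UCb d)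
    (hV : IsC0Semigroup V)
    (hgen : IsGenerator V (opH a b c).closure) :
    ∀ u₀ : UCb d,
      -- `t ↦ V(t)u₀` is the unique mild solution
      IsMildSolution (opH a b c).closure u₀
        (fun t => V t u₀) ∧
      (∀ u : ℝ → UCb d,
        IsMildSolution (opH a b c).closure u₀ u →
          ∀ t : ℝ, 0 ≤ t → u t = V t u₀) ∧
      -- it is a classical solution for initial data in the domain of the closure of `H`
      (u₀ ∈ (opH a b c).closure.domain →
        IsClassicalSolution (opH a b c).closure u₀
          (fun t => V t u₀)) ∧
      -- it is bounded on `[0, T] × ℝ^d`, and uniformly continuous in `x` for each `t`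
      (∀ T : ℝ, 0 < T → ∃ M : ℝ, ∀ t ∈ Set.Icc 0 T, ∀ x, |(V t u₀) x| ≤ M) ∧
      (∀ t : ℝ, 0 ≤ t → UniformContinuous (fun x => (V t u₀) x)) ∧
      -- for each `t` it depends on `u₀` continuously, uniformly in `x`
      (∀ t : ℝ, 0 ≤ t → ∀ ε : ℝ, 0 < ε → ∃ δ : ℝ, 0 < δ ∧ ∀ v₀ : UCb d,
        (∀ x, |v₀ x - u₀ x| ≤ δ) → ∀ x, |(V t v₀) x - (V t u₀) x| ≤ ε) ∧
      -- it is the limit of `S(t/n)^n u₀`: pointwise, and in `UC_b(ℝ^d)` uniformly in `t ∈ [0, t₀]`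
      (∀ t : ℝ, 0 ≤ t → ∀ x, Filter.Tendsto
        (fun n : ℕ => (((opS a b c (t / n)) ^ n) u₀) x) Filter.atTop
        (nhds ((V t u₀) x))) ∧
      (∀ t₀ : ℝ, 0 < t₀ → TendstoUniformlyOn
        (fun (n : ℕ) (t : ℝ) => ((opS a b c (t / n)) ^ n) u₀)
        (fun t => V t u₀) Filter.atTop (Set.Icc 0 t₀)) := by
  intro u₀
  -- The graph of the closure is the closure of the graph, so consistency on `C_b^∞` is all that
  -- Chernoff's theorem needs.
  have hcl := hH.graph_closure_eq_closure_graph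
  have hunif : ∀ t₀ : ℝ, 0 ≤ t₀ → TendstoUniformlyOn
      (fun (n : ℕ) (t : ℝ) => ((opS a b c (t / n)) ^ n) u₀)
      (fun t => V t u₀) Filter.atTop (Set.Icc 0 t₀) := fun t₀ ht₀ =>
    tendstoUniformlyOn_pow_of_consistent (G := ((opH a b c).graph : Set (UCb d × UCb d))) hV hgen
      (fun p hp => by
        obtain ⟨φ, h1, h2⟩ := (LinearPMap.mem_graph_iff _).1 hp
        rw [← h1, ← h2]
        exact tendsto_opS_sub_div hd a b c φ)
      (by rw [← hcl, Submodule.topologicalClosure_coe])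
      (norm_nonneg c) (opS_zero hd a b c) (fun h hh => norm_opS_le a b c hh) u₀ ht₀
  refine ⟨hgen.isMildSolution hV u₀, fun u hu t ht => hgen.mildSolution_unique hV hu ht,
    hgen.isClassicalSolution hV, fun T _ => ?_, fun t _ => (V t u₀).isBUC.2, fun t _ ε hε => ?_,
    fun t ht x => ?_, fun t₀ ht₀ => hunif t₀ ht₀.le⟩
  · obtain ⟨M, -, hM⟩ := hV.exists_bound T
    exact ⟨M * ‖u₀‖, fun t ht x =>
      ((V t u₀).abs_apply_le x).trans ((V t).le_of_opNorm_le (hM t ht) _)⟩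
  · refine ⟨ε / (‖V t‖ + 1), by positivity, fun v₀ hv x => ?_⟩
    have h1 : ‖v₀ - u₀‖ ≤ ε / (‖V t‖ + 1) := (UCb.norm_le (by positivity)).2 hv
    have h2 : ‖V t v₀ - V t u₀‖ ≤ ε := by
      rw [← map_sub]
      calc _ ≤ (‖V t‖ + 1) * (ε / (‖V t‖ + 1)) :=
            (V t).le_of_opNorm_le_of_le (le_add_of_nonneg_right zero_le_one) h1
        _ = ε := by field_simp
    exact ((V t v₀ - V t u₀).abs_apply_le x).trans h2
  · have h1 := tendsto_iff_norm_sub_tendsto_zero.1 ((hunif t ht).tendsto_at ⟨ht, le_rfl⟩)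
    exact tendsto_iff_norm_sub_tendsto_zero.2 (squeeze_zero (fun _ => norm_nonneg _)
      (fun n => (((opS a b c (t / n)) ^ n) u₀ - V t u₀).abs_apply_le x) h1)
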